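/- Let $N\ge 1$ and $\ell\ge 0$, let $\lambda=(\lambda_1\ge\dots\ge\lambda_\ell\ge 0)$ and $\mu=(\mu_1\ge\dots\ge\mu_\ell\ge 0)$ be partitions of the same length $\ell=\ell(\lambda)=\ell(\mu)$ (trailing zeroes allowed and counted), put $\rho=(\ell-1,\ell-2,\dots,0)$, and let $M\ge 0$ be an integer with $M\ge\max(\lambda_1,\mu_1)+\ell-1$ if $\ell\ge1$. Let $x_i,y_i,A_i,B_i$ ($1\le i\le N$) be elements of a commutative ring $R$. *The models.* Consider the rectangular grid with $N$ rows and $M+1$ columns, the columns being labelled $0,\dots,M$ from left to right. A state assigns a spin $+$ or $-$ to every edge, subject to the boundary conditions below; its weight is the product over all vertices of the Boltzmann weights, and the partition function $Z$ is the sum of the weights of all states. We list the spins around a vertex in the order (left, top, right, bottom); configurations not listed have weight $0$. In $\mathfrak S_{\lambda+\rho/\mu+\rho}$ the rows are labelled $1,\dots,N$ from bottom to top, all left and right boundary edges are $+$, the bottom boundary edge in column $j$ is $-$ if $j$ is a part of $\lambda+\rho$ and $+$ otherwise, and the top boundary edge in column $j$ is $-$ if $j$ is a part of $\mu+\rho$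 and $+$ otherwise. The weights in row $i$ are $$(++++)\mapsto A_i,\quad (----)\mapsto y_iA_iB_i,\quad (+-+-)\mapsto A_iB_i,$$ $$(-+-+)\mapsto x_iA_i,\quad (-++-)\mapsto (x_i+y_i)A_iB_i,\quad (+--+)\mapsto A_i.$$ In $\mathfrak S^*_{\lambda+\rho/\mu+\rho}$, where the $A_i,B_i$ are assumed invertible, the rows are labelled $1,\dots,N$ from top to bottom, all left and right boundary edges are $+$, the top boundary edges are $-$ exactly in the columns that are parts of $\lambda+\rho$, and the bottom boundary edges are $-$ exactly in the columns that are parts of $\mu+\rho$. The weights in row $i$ are $$(++++)\mapsto A_i^{-1},\quad (----)\mapsto x_iA_i^{-1}B_i^{-1},\quad (+-+-)\mapsto A_i^{-1}B_i^{-1},$$ $$(-+-+)\mapsto y_iA_i^{-1},\quad (++--)\mapsto (x_i+y_i)A_i^{-1},\quad (--++)\mapsto A_i^{-1}B_i^{-1}.$$ *Supersymmetric Schur functions.* For indeterminates $x_1,\dots,x_N,y_1,\dots,y_N$, with $y_k:=0$ for $k>N$, put $[t|\boldsymbol y]^r=(t+y_1)\cdots(t+y_r)$ and, for integers $e_1,\dots,e_N\ge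 0$, $\mathcal A_{e}=\det_{1\le i,j\le N}\big([x_i|\boldsymbol y]^{e_j}\big)$. For an integer $r\ge0$ let $$h_r[\boldsymbol x|\boldsymbol y]=\frac{\mathcal A_{(r+N-1,\,N-2,\,\dots,\,1,\,0)}}{\mathcal A_{(N-1,\,N-2,\,\dots,\,1,\,0)}}\in\mathbb Z[\boldsymbol x,\boldsymbol y],$$ and let $h_r[\boldsymbol x|\boldsymbol y]=0$ for $r<0$. The skew supersymmetric Schur function is the polynomial $$s_{\lambda/\mu}[\boldsymbol x|\boldsymbol y]=\det_{1\le i,j\le\ell} h_{\lambda_i-\mu_j-i+j}[\boldsymbol x|\boldsymbol y],$$ which may be evaluated at elements of $R$. *Claim.* For all $x_i,y_i,A_i,B_i\in R$, $$Z(\mathfrak S_{\lambda+\rho/\mu+\rho})=\prod_{i=1}^N A_i^{M+1}B_i^{\ell}\cdot s_{\lambda/\mu}[x_1,\dots,x_N|y_1,\dots,y_N],$$ and, if all $A_i$ and $B_i$ are invertible, $$Z(\mathfrak S^*_{\lambda+\rho/\mu+\rho})=\prod_{i=1}^N A_i^{-(M+1)}B_i^{-\ell}\cdot s_{\lambda/\mu}[y_1,\dots,y_N|x_1,\dots,x_N].$$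 -/

import Mathlib

namespace SixVertex

/-! ### Partitions -/

/-- The `ρ`-shift of a sequence of length `n`:
`lam + ρ = (lam₁ + (n-1), lam₂ + (n-2), …, lamₙ)`. The index set `Fin n` starts at `0`. -/
def rhoShift {n : ℕ} (lam : Fin n → ℕ) : Fin n → ℕ :=
  fun i => lam i + (n - 1 - (i : ℕ))

/-! ### Six-vertex lattice models -/

/-- The two spins. -/
inductive Spin where
  | plus
  | minus
deriving DecidableEq

instance : Fintype Spin where
  elems := {Spin.plus, Spin.minus}
  complete := fun s => by cases s <;> simp

/-- An assignment of spins to all edges of a grid with `N` rows and `M + 1` columns. Rows are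
numbered here by their geometric position from bottom to top, columns from left to right.
`s.1 k j` is the horizontal edge of row `k` immediately to the left of column `j` (for `j = M + 1`:
the right boundary edge); `s.2 k j` is the vertical edge of column `j` immediately below row `k`
(for `k = N`: the top boundary edge). -/
abbrev State (N M : ℕ) : Type :=
  (Fin N → Fin (M + 2) → Spin) × (Fin (N + 1) → Fin (M + 1) → Spin)

/-- The boundary spins given by a set of parts: `-` on the parts, `+` elsewhere. -/
def boundarySpin {l : ℕ} (M : ℕ) (part : Fin l → ℕ) (j : Fin (M + 1)) : Spin :=
  open Classical in if ∃ i, part i = (j : ℕ) then Spin.minus else Spin.plus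

/-- The boundary conditions: left and right boundary edges are all `+`, bottom and top boundary
edges are prescribed. -/
def HasBoundary {N M : ℕ} (bottom top : Fin (M + 1) → Spin) (s : State N M) : Prop :=
  (∀ k, s.1 k 0 = Spin.plus) ∧ (∀ k, s.1 k (Fin.last (M + 1)) = Spin.plus) ∧
    (∀ j, s.2 0 j = bottom j) ∧ (∀ j, s.2 (Fin.last N) j = top j)

/-- The partition function of a model whose vertex in (geometric) row `k` has the Boltzmann weight
`wt k left top right bottom`: the sum over all states with the given boundary of the product of the
weights of all vertices. Non-admissible vertices have weight `0`. -/
noncomputable def partitionFunction {R : Type*} [CommRing R] {N M : ℕ}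
    (wt : Fin N → Spin → Spin → Spin → Spin → R) (bottom top : Fin (M + 1) → Spin) : R :=
  open Classical in
  ∑ s : State N M with HasBoundary bottom top s,
    ∏ k : Fin N, ∏ j : Fin (M + 1),
      wt k (s.1 k j.castSucc) (s.2 k.succ j) (s.1 k j.succ) (s.2 k.castSucc j)

/-- The Boltzmann weights of `𝔖` (arguments: `left top right bottom`), in the order
`a₁, a₂, b₁, b₂, c₁, c₂`. -/
def weight {R : Type*} [CommRing R] (x y A B : R) : Spin → Spin → Spin → Spin → R
  | .plus, .plus, .plus, .plus => A
  | .minus, .minus, .minus, .minus => y * A * B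
  | .plus, .minus, .plus, .minus => A * B
  | .minus, .plus, .minus, .plus => x * A
  | .minus, .plus, .plus, .minus => (x + y) * A * B
  | .plus, .minus, .minus, .plus => A
  | _, _, _, _ => 0

/-- The Boltzmann weights of `𝔖*` (arguments: `left top right bottom`), in the order
`a₁, a₂, b₁, b₂, c₁, c₂`. -/
def weightStar {R : Type*} [CommRing R] (x y : R) (A B : Rˣ) : Spin → Spin → Spin → Spin → R
  | .plus, .plus, .plus, .plus => (A⁻¹ : Rˣ)
  | .minus, .minus, .minus, .minus => x * (A⁻¹ : Rˣ) * (B⁻¹ : Rˣ)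
  | .plus, .minus, .plus, .minus => (A⁻¹ : Rˣ) * (B⁻¹ : Rˣ)
  | .minus, .plus, .minus, .plus => y * (A⁻¹ : Rˣ)
  | .plus, .plus, .minus, .minus => (x + y) * (A⁻¹ : Rˣ)
  | .minus, .minus, .plus, .plus => (A⁻¹ : Rˣ) * (B⁻¹ : Rˣ)
  | _, _, _, _ => 0

/-- `Z(𝔖_{lam/mu}(x, y, A, B))` with `M + 1` columns, for strict partitions `lam`, `mu`: rows are
labelled from bottom to top, the bottom boundary is `lam` and the top boundary is `mu`. -/
noncomputable def Z {R : Type*} [CommRing R] {N l m : ℕ} (M : ℕ) (x y A B : Fin N → R)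
    (lam : Fin l → ℕ) (mu : Fin m → ℕ) : R :=
  partitionFunction (fun k => weight (x k) (y k) (A k) (B k))
    (boundarySpin M lam) (boundarySpin M mu)

/-- `Z(𝔖*_{lam/mu}(x, y, A, B))` with `M + 1` columns, for strict partitions `lam`, `mu`: rows are
labelled from top to bottom, the bottom boundary is `mu` and the top boundary is `lam`. -/
noncomputable def ZStar {R : Type*} [CommRing R] {N l m : ℕ} (M : ℕ) (x y : Fin N → R)
    (A B : Fin N → Rˣ) (lam : Fin l → ℕ) (mu : Fin m → ℕ) : R :=
  partitionFunction (fun k => weightStar (x k.rev) (y k.rev) (A k.rev) (B k.rev))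
    (boundarySpin M mu) (boundarySpin M lam)

/-! ### Supersymmetric Schur functions -/

/-- `[t|y]^r = (t + y₁)(t + y₂)⋯(t + y_r)`, where `y_k = 0` for `k > N`. -/
def shiftedPow {R : Type*} [CommRing R] {N : ℕ} (t : R) (y : Fin N → R) (r : ℕ) : R :=
  ∏ k ∈ Finset.range r, (t + if h : k < N then y ⟨k, h⟩ else 0)

/-- The alternant `A_e = det ([x_i|y]^{e_j})`. -/
def alternant {R : Type*} [CommRing R] {N : ℕ} (x y : Fin N → R) (e : Fin N → ℕ) : R :=
  Matrix.det (Matrix.of fun i j : Fin N => shiftedPow (x i) y (e j))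

open Polynomial in
/-- The alternant `A_ρ` divides every other alternant. -/
theorem alternant_rho_dvd {R : Type*} [CommRing R] {N : ℕ} (x y : Fin N → R) (e : Fin N → ℕ) :
    alternant x y (rhoShift 0) ∣ alternant x y e := by
  nontriviality R
  let P : ℕ → R[X] := fun r => ∏ k ∈ Finset.range r, (X + C (if h : k < N then y ⟨k, h⟩ else 0))
  have hP : ∀ t r, (P r).eval t = shiftedPow t y r := by
    intro t r
    simp only [P, shiftedPow, eval_prod, eval_add, eval_X, eval_C]
  have hdeg : ∀ r, (P r).natDegree = r := by
    intro r
    simp only [P]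
    rw [natDegree_prod_of_monic _ _ (fun _ _ => monic_X_add_C _)]
    simp
  have hmon : ∀ r, (P r).Monic := fun r => monic_prod_of_monic _ _ (fun _ _ => monic_X_add_C _)
  have h1 : (Matrix.vandermonde x).det
      = (Matrix.of fun i j : Fin N => shiftedPow (x i) y (j : ℕ)).det := by
    rw [Matrix.det_eval_matrixOfPolynomials_eq_det_vandermonde x (fun j => P j)
      (fun i => hdeg i) (fun i => hmon i)]
    simp only [hP]
  have h2 : alternant x y (rhoShift 0) ∣ (Matrix.vandermonde x).det := by
    rw [h1]
    have := Matrix.det_permute' (Fin.revPerm (n := N))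
      (Matrix.of fun i j : Fin N => shiftedPow (x i) y (j : ℕ))
    have h3 : alternant x y (rhoShift 0) = ((Matrix.of fun i j : Fin N =>
        shiftedPow (x i) y (j : ℕ)).submatrix id (Fin.revPerm (n := N))).det := by
      unfold alternant
      congr 1
      ext i j
      simp only [rhoShift, Matrix.of_apply, Matrix.submatrix_apply, id, Fin.revPerm_apply,
        Fin.val_rev, Pi.zero_apply, zero_add]
      congr 1
      omega
    rw [h3, this]
    rcases Int.units_eq_one_or (Equiv.Perm.sign (Fin.revPerm (n := N))) with h | h <;>
      simp [h]
  refine h2.trans ?_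
  let Q : R[X] := ∏ i, (X - C (x i))
  have hQ : Q.Monic := monic_prod_of_monic _ _ (fun _ _ => monic_X_sub_C _)
  have hQdeg : Q.natDegree = N := by
    simp only [Q]
    rw [natDegree_prod_of_monic _ _ (fun _ _ => monic_X_sub_C _)]
    simp
  have hQ0 : ∀ i, Q.eval (x i) = 0 := by
    intro i
    simp only [Q, eval_prod]
    exact Finset.prod_eq_zero (Finset.mem_univ i) (by simp)
  refine ⟨(Matrix.of fun i j : Fin N => (P (e j) %ₘ Q).coeff i).det, ?_⟩
  rw [← Matrix.det_mul]
  unfold alternant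
  congr 1
  ext i j
  rw [Matrix.of_apply, ← hP, Matrix.mul_apply]
  have h4 : (P (e j)).eval (x i) = (P (e j) %ₘ Q).eval (x i) := by
    conv_lhs => rw [← modByMonic_add_div (P (e j)) Q]
    simp [hQ0]
  have h5 : (P (e j) %ₘ Q).degree < N := by
    have := degree_modByMonic_lt (P (e j)) hQ
    rwa [degree_eq_natDegree hQ.ne_zero, hQdeg] at this
  rw [h4]
  rcases Nat.eq_zero_or_pos N with hN | hN
  · exact absurd i.2 (by omega)
  rw [eval_eq_sum_range' (n := N)]
  · rw [Finset.sum_range]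
    refine Finset.sum_congr rfl fun k _ => ?_
    simp only [Matrix.vandermonde_apply, Matrix.of_apply]
    ring
  · by_cases h0 : P (e j) %ₘ Q = 0
    · simpa [h0] using hN
    · exact (natDegree_lt_iff_degree_lt h0).2 h5

/-- The universal polynomial `s_lam[x|y] = A_{lam+ρ} / A_ρ` in the indeterminates
`x_1, …, x_N` (`Sum.inl`) and `y_1, …, y_N` (`Sum.inr`). The quotient exists by
`alternant_rho_dvd` and is unique, since `A_ρ` is (up to sign) the Vandermonde determinant in the
`x_i` and hence a nonzero element of an integral domain. -/
noncomputable def superSchurPoly (N : ℕ) (lam : Fin N → ℕ) : MvPolynomial (Fin N ⊕ Fin N) ℤ :=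
  Classical.choose (alternant_rho_dvd (fun i => MvPolynomial.X (Sum.inl i))
    (fun i => MvPolynomial.X (Sum.inr i)) (rhoShift lam))

/-- The one-row partition `(r)`, padded with zeroes to length `N`. -/
def oneRow (N r : ℕ) : Fin N → ℕ := fun i => if (i : ℕ) = 0 then r else 0

/-- `h_r[x|y] = s_{(r)}[x|y]` for `r ≥ 0`, and `h_r[x|y] = 0` for `r < 0`. -/
noncomputable def superH {R : Type*} [CommRing R] {N : ℕ} (x y : Fin N → R) (r : ℤ) : R :=
  if 0 ≤ r then MvPolynomial.aeval (Sum.elim x y) (superSchurPoly N (oneRow N r.toNat)) else 0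

/-- The skew supersymmetric Schur function
`s_{lam/mu}[x|y] = det (h_{lam_i - mu_j - i + j}[x|y])` for partitions of the same length `l`. -/
noncomputable def skewSuperSchur {R : Type*} [CommRing R] {N l : ℕ} (lam mu : Fin l → ℕ)
    (x y : Fin N → R) : R :=
  Matrix.det (Matrix.of fun i j : Fin l =>
    superH x y ((lam i : ℤ) - (mu j : ℤ) - ((i : ℕ) : ℤ) + ((j : ℕ) : ℤ)))

end SixVertex

/-!
The `-` spins are fermions. Encode a row of vertical edges in the columns `0, …, M` as the wedge of
the basis vectors `T ^ j` of `R[T] / (T ^ (M + 1))` at its `-` columns. A row of free-fermionic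
vertices then acts as `A ^ (M + 1)` times the exterior power of multiplication by
`B (1 + y T) / (1 - x T)`: in a row the `-` spin of a column either goes straight through or moves
to the right, picking up a factor `x` for each column it crosses, and the free-fermion relation
makes the contributions of colliding spins agree with the signs of the exterior algebra. Hence `Z`
is `∏ Aᵢ ^ (M + 1) Bᵢ ^ ℓ` times a minor of the matrix of multiplication by
`∏ (1 + yᵢ T) / (1 - xᵢ T)`.

The coefficients of this series are the `h_r[x|y]`: modulo `∏ (t - xᵢ)` the shifted power
`[t|y]^(r+N-1)` has degree at most `N - 1`, so the quotient of alternants defining `h_r` is its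
coefficient of `t ^ (N - 1)`, which is a residue at infinity. The minor is therefore the
Jacobi–Trudi determinant.

The model `𝔖*` turned upside down is again free-fermionic, with `x` and `y` exchanged and `A`, `B`
inverted.
-/

namespace SixVertex

variable {R : Type*} [CommRing R]

/-! ### Transfer matrices -/

section Path

variable {S : Type*} [Fintype S] [DecidableEq S]

/-- The sum over all paths `a = s 0, …, s n = c` of the product of the step weights
`W j (s j) (s (j + 1))`: an entry of the product of the transfer matrices `W 0, …, W (n - 1)`. -/
def pathSum {n : ℕ} (W : Fin n → S → S → R) (a c : S) : R :=
  ∑ s : Fin (n + 1) → S with s 0 = a ∧ s (Fin.last n) = c, ∏ j, W j (s j.castSucc) (s j.succ)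

theorem pathSum_zero (W : Fin 0 → S → S → R) (a c : S) :
    pathSum W a c = if a = c then 1 else 0 := by
  rw [pathSum, Finset.sum_filter, ← (Equiv.funUnique (Fin 1) S).symm.sum_comp,
    Finset.sum_eq_single a]
  · simp
  · simp +contextual
  · simp

theorem pathSum_succ {n : ℕ} (W : Fin (n + 1) → S → S → R) (a c : S) :
    pathSum W a c = ∑ b, W 0 a b * pathSum (Fin.tail W) b c := by
  simp only [pathSum, Finset.sum_filter, Finset.mul_sum]
  rw [← (Fin.consEquiv fun _ => S).sum_comp, Fintype.sum_prod_type, Finset.sum_eq_single a,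
    Finset.sum_comm]
  · refine Finset.sum_congr rfl fun s _ => ?_
    rw [Finset.sum_eq_single (s 0)]
    · simp [Fin.consEquiv, Fin.prod_univ_succ, ← Fin.succ_last, Fin.tail]
    · intro b _ hb
      simp [hb.symm]
    · simp
  · intro b _ hb
    simp [Fin.consEquiv, hb]
  · simp

theorem pathSum_rev {n : ℕ} (W : Fin n → S → S → R) (a c : S) :
    pathSum W a c = pathSum (fun j s s' => W j.rev s' s) c a := by
  simp only [pathSum, Finset.sum_filter]
  rw [← (Fin.revPerm.arrowCongr (Equiv.refl S)).sum_comp]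
  refine Finset.sum_congr rfl fun s _ => ?_
  rw [← Equiv.prod_comp Fin.revPerm]
  simp [and_comm, Fin.rev_succ, Fin.rev_castSucc]

end Path

/-- The partition function of a single row with vertex weights `w`, left boundary edge `σ` and right
boundary edge `+`: the transfer matrix between two consecutive rows of vertical edges. -/
def rowFunction {n : ℕ} (w : Spin → Spin → Spin → Spin → R) (σ : Spin)
    (bottom top : Fin n → Spin) : R :=
  pathSum (fun j s s' => w s (top j) s' (bottom j)) σ .plus

theorem rowFunction_zero (w : Spin → Spin → Spin → Spin → R) (σ : Spin)
    (bottom top : Fin 0 → Spin) :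
    rowFunction w σ bottom top = if σ = .plus then 1 else 0 :=
  pathSum_zero _ _ _

theorem rowFunction_succ {n : ℕ} (w : Spin → Spin → Spin → Spin → R) (σ : Spin)
    (bottom top : Fin (n + 1) → Spin) :
    rowFunction w σ bottom top = ∑ τ, w σ (top 0) τ (bottom 0) *
      rowFunction w τ (Fin.tail bottom) (Fin.tail top) :=
  pathSum_succ _ _ _

theorem partitionFunction_eq_pathSum {N M : ℕ} (wt : Fin N → Spin → Spin → Spin → Spin → R)
    (bottom top : Fin (M + 1) → Spin) :
    partitionFunction wt bottom top =
      pathSum (fun k => rowFunction (wt k) .plus) bottom top := by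
  classical
  simp only [partitionFunction, pathSum, rowFunction, Finset.prod_univ_sum]
  rw [Finset.sum_filter, Fintype.sum_prod_type_right, Finset.sum_filter]
  refine Finset.sum_congr rfl fun v _ => ?_
  rw [← Finset.sum_filter]
  split_ifs with hv
  · refine Finset.sum_congr (Finset.ext fun h => ?_) fun _ _ => rfl
    simp [HasBoundary, forall_and, ← hv.1, ← hv.2]
  · rw [Finset.filter_false_of_mem, Finset.sum_empty]
    exact fun h _ hh => hv ⟨funext hh.2.2.1, funext hh.2.2.2⟩

theorem partitionFunction_flip {N M : ℕ} (wt : Fin N → Spin → Spin → Spin → Spin → R)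
    (bottom top : Fin (M + 1) → Spin) :
    partitionFunction wt bottom top =
      partitionFunction (fun k l t r b => wt k.rev l b r t) top bottom := by
  rw [partitionFunction_eq_pathSum, pathSum_rev, partitionFunction_eq_pathSum]
  rfl

theorem sum_spin {S : Type*} [AddCommMonoid S] (f : Spin → S) :
    ∑ s, f s = f .plus + f .minus := by
  rw [show (Finset.univ : Finset Spin) = {.plus, .minus} from rfl, Finset.sum_pair (by decide)]

/-- Six-vertex weights (arguments: left, top, right, bottom of the vertex) that are free-fermionic
when `u * v = x + y`. They cover `𝔖` with `u = x + y`, `v = 1`, and `𝔖*` upside down with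
`u = 1`. -/
def freeFermionWeight (x y A B u v : R) : Spin → Spin → Spin → Spin → R
  | .plus, .plus, .plus, .plus => A
  | .minus, .minus, .minus, .minus => y * A * B
  | .plus, .minus, .plus, .minus => A * B
  | .minus, .plus, .minus, .plus => x * A
  | .minus, .plus, .plus, .minus => u * A * B
  | .plus, .minus, .minus, .plus => v * A
  | _, _, _, _ => 0

theorem weight_eq_freeFermionWeight (x y A B : R) :
    weight x y A B = freeFermionWeight x y A B (x + y) 1 := by
  funext l t r b
  cases l <;> cases t <;> cases r <;> cases b <;> simp [weight, freeFermionWeight]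

theorem weightStar_eq_freeFermionWeight (x y : R) (A B : Rˣ) (l t r b : Spin) :
    weightStar x y A B l b r t =
      freeFermionWeight y x (A⁻¹ : Rˣ) (B⁻¹ : Rˣ) 1 (x + y) l t r b := by
  cases l <;> cases t <;> cases r <;> cases b <;> simp [weightStar, freeFermionWeight]

/-! ### Fermionic states -/

section Wedge

variable {V : Type*} [AddCommGroup V] [Module R V]

open ExteriorAlgebra

variable (R) in
/-- The wedge of the vectors `v j` at the `-` spins of the row `b` of vertical edges, in increasing
order of `j`: the fermionic state of that row. -/
def wedge {n : ℕ} (v : Fin n → V) (b : Fin n → Spin) : ExteriorAlgebra R V :=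
  (((List.finRange n).filter (b · = .minus)).map fun j => ι R (v j)).prod

theorem wedge_zero (v : Fin 0 → V) (b : Fin 0 → Spin) : wedge R v b = 1 := rfl

theorem wedge_succ {n : ℕ} (v : Fin (n + 1) → V) (b : Fin (n + 1) → Spin) :
    wedge R v b = (if b 0 = .minus then ι R (v 0) else 1) * wedge R (Fin.tail v) (Fin.tail b) := by
  simp only [wedge, List.finRange_succ, List.filter_cons, List.filter_map, decide_eq_true_eq]
  split_ifs
  · rw [List.map_cons, List.prod_cons, List.map_map]
    rfl
  · rw [List.map_map, one_mul]
    rfl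

/-- The `-` spins of `b` are exactly at the positions listed by `p`. -/
def IsMinusSet {l n : ℕ} (p : Fin l → Fin n) (b : Fin n → Spin) : Prop :=
  ∀ j, b j = .minus ↔ j ∈ Set.range p

theorem exists_isMinusSet {n : ℕ} (b : Fin n → Spin) :
    ∃ (l : ℕ) (p : Fin l → Fin n), StrictMono p ∧ IsMinusSet p b :=
  let s := {j | b j = .minus}.toFinset
  ⟨_, s.orderEmbOfFin rfl, OrderEmbedding.strictMono _, fun j => by simp [s]⟩

theorem IsMinusSet.eq {l n : ℕ} {p : Fin l → Fin n} {b b' : Fin n → Spin} (hb : IsMinusSet p b)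
    (hb' : IsMinusSet p b') : b = b' := by
  funext j
  have := (hb j).trans (hb' j).symm
  cases h : b j <;> cases h' : b' j <;> simp_all

theorem wedge_eq_ιMulti {l n : ℕ} {p : Fin l → Fin n} (hp : StrictMono p) {b : Fin n → Spin}
    (hb : IsMinusSet p b) (v : Fin n → V) : wedge R v b = ιMulti R l (v ∘ p) := by
  have hfilter : (List.finRange n).filter (b · = .minus) = List.ofFn p :=
    List.SortedLT.eq_of_mem_iff ((List.sortedLT_finRange n).pairwise.filter _).sortedLT
      hp.sortedLT_ofFn fun j => by simp [hb j]
  rw [wedge, hfilter, List.map_ofFn, ιMulti_apply]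
  rfl

/-- The linear functional taking a wedge of `l` vectors of `R ^ n` to the minor of their coordinates
in the columns `p`, and wedges of any other length to `0`. For increasing `p` it reads off the
coefficient of one basis wedge. -/
noncomputable def minorAt {l n : ℕ} (p : Fin l → Fin n) :
    ExteriorAlgebra R (Fin n → R) →ₗ[R] R :=
  liftAlternating (Pi.single l (Matrix.detRowAlternating.compLinearMap (LinearMap.funLeft R R p)))

theorem minorAt_wedge {l n : ℕ} (p : Fin l → Fin n) {q : Fin l → Fin n} (hq : StrictMono q)
    {b : Fin n → Spin} (hb : IsMinusSet q b) (v : Fin n → Fin n → R) :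
    minorAt p (wedge R v b) = (Matrix.of fun i j => v (q i) (p j)).det := by
  rw [wedge_eq_ιMulti hq hb, minorAt, liftAlternating_apply_ιMulti, Pi.single_eq_same]
  rfl

theorem minorAt_wedge_of_ne {l m n : ℕ} (p : Fin l → Fin n) {q : Fin m → Fin n}
    (hq : StrictMono q) (hlm : m ≠ l) {b : Fin n → Spin} (hb : IsMinusSet q b)
    (v : Fin n → Fin n → R) : minorAt p (wedge R v b) = 0 := by
  rw [wedge_eq_ιMulti hq hb, minorAt, liftAlternating_apply_ιMulti, Pi.single_eq_of_ne hlm,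
    AlternatingMap.zero_apply]

theorem minorAt_wedge_single_self {l n : ℕ} {p : Fin l → Fin n} (hp : StrictMono p)
    {b : Fin n → Spin} (hb : IsMinusSet p b) :
    minorAt p (wedge R (fun j => Pi.single j 1) b) = 1 := by
  rw [minorAt_wedge p hp hb, ← Matrix.det_one (n := Fin l) (R := R)]
  congr 1
  ext i j
  simp [Matrix.one_apply, Pi.single_apply, hp.injective.eq_iff, eq_comm]

theorem minorAt_wedge_single_of_not {l n : ℕ} {p : Fin l → Fin n} (hp : StrictMono p)
    {b : Fin n → Spin} (hb : ¬ IsMinusSet p b) :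
    minorAt p (wedge R (fun j => Pi.single j 1) b) = 0 := by
  obtain ⟨m, q, hq, hqb⟩ := exists_isMinusSet b
  obtain rfl | hlm := eq_or_ne m l
  · have hne : Set.range p ≠ Set.range q := fun h => hb fun j => (hqb j).trans (by rw [h])
    obtain ⟨i, hi⟩ : ∃ i, q i ∉ Set.range p := by
      by_contra! h
      refine hne (Set.eq_of_subset_of_ncard_le (Set.range_subset_iff.2 h) ?_).symm
      rw [Set.ncard_range_of_injective hp.injective, Set.ncard_range_of_injective hq.injective]
    rw [minorAt_wedge p hq hqb]
    refine Matrix.det_eq_zero_of_row_eq_zero i fun j => ?_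
    exact Pi.single_eq_of_ne (fun h => hi ⟨j, h⟩) 1
  · exact minorAt_wedge_of_ne p hq hlm hqb _

theorem sum_rowFunction_smul_wedge_succ (w : Spin → Spin → Spin → Spin → R) (σ : Spin) {n : ℕ}
    (t : Fin (n + 1) → Spin) (g : Fin (n + 1) → V) :
    ∑ b, rowFunction w σ b t • wedge R g b =
      ∑ β, ∑ τ, w σ (t 0) τ β • ((if β = .minus then ι R (g 0) else 1) *
        ∑ b, rowFunction w τ b (Fin.tail t) • wedge R (Fin.tail g) b) := by
  rw [← (Fin.consEquiv fun _ => Spin).sum_comp, Fintype.sum_prod_type]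
  refine Finset.sum_congr rfl fun β _ => ?_
  simp only [Finset.mul_sum, Finset.smul_sum]
  rw [Finset.sum_comm]
  refine Finset.sum_congr rfl fun b _ => ?_
  simp [rowFunction_succ, wedge_succ, Fin.consEquiv, Finset.sum_smul, mul_smul]

theorem sum_freeFermionWeight_smul {x y u v : R} (huv : u * v = x + y) (A B : R) (a s : V)
    (σ t : Spin) :
    ∑ β, ∑ τ, freeFermionWeight x y A B u v σ t τ β •
        ((if β = .minus then ι R a else 1) * (if τ = .minus then u • ι R s else 1)) =
      A • ((if σ = .minus then u • ι R (B • a + x • s) else 1) *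
        (if t = .minus then ι R (B • a + (x + y) • s) else 1)) := by
  have hswap : ι R s * ι R a = -(ι R a * ι R s) :=
    eq_neg_of_add_eq_zero_left (ι_add_mul_swap s a)
  rw [← huv]
  obtain rfl : y = u * v - x := by rw [huv]; ring
  cases σ <;> cases t <;>
    simp only [sum_spin, freeFermionWeight, map_add, map_smul, mul_add, add_mul, hswap, ι_sq_zero,
      reduceCtorEq, if_true, if_false, smul_mul_assoc, mul_smul_comm, mul_one, one_mul, zero_smul,
      zero_add, add_zero, smul_zero] <;> module

-- The vector `u • r j` is the fermion on a `-` horizontal edge entering column `j` from the left: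
-- it leaves downwards in column `j` (`B • g j`) or travels on to the right (`x • r (j + 1)`).
theorem sum_rowFunction_smul_wedge {x y u v : R} (huv : u * v = x + y) (A B : R) {n : ℕ}
    (g : Fin n → V) (r : Fin (n + 1) → V) (hlast : r (Fin.last n) = 0)
    (hr : ∀ j : Fin n, r j.castSucc = B • g j + x • r j.succ) (σ : Spin) (t : Fin n → Spin) :
    ∑ b, rowFunction (freeFermionWeight x y A B u v) σ b t • wedge R g b =
      A ^ n • ((if σ = .minus then u • ι R (r 0) else 1) *
        wedge R (fun j => B • g j + (x + y) • r j.succ) t) := by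
  induction n generalizing σ with
  | zero => cases σ <;> simp_all [rowFunction_zero, wedge_zero]
  | succ n ih =>
    have ih' := fun τ => ih (Fin.tail g) (Fin.tail r) hlast (fun j => hr j.succ) τ (Fin.tail t)
    have hr0 : r 0 = B • g 0 + x • r 1 := hr 0
    calc ∑ b, rowFunction (freeFermionWeight x y A B u v) σ b t • wedge R g b
        = A ^ n • ((∑ β, ∑ τ, freeFermionWeight x y A B u v σ (t 0) τ β •
            ((if β = .minus then ι R (g 0) else 1) * (if τ = .minus then u • ι R (r 1) else 1))) *
              wedge R (fun j => B • Fin.tail g j + (x + y) • Fin.tail r j.succ) (Fin.tail t)) := by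
          simp only [sum_rowFunction_smul_wedge_succ, ih', Finset.sum_mul, Finset.smul_sum,
            mul_smul_comm, smul_mul_assoc, mul_assoc, smul_comm _ (A ^ n)]
          rfl
      _ = _ := by
          rw [sum_freeFermionWeight_smul huv, hr0, wedge_succ, pow_succ, mul_smul, smul_mul_assoc,
            mul_assoc]
          rfl

end Wedge

/-! ### Multiplication by power series -/

section Transfer

open PowerSeries

theorem mk_pow_eq_one_add (x : R) :
    (PowerSeries.mk fun n => x ^ n) = 1 + C x * X * PowerSeries.mk fun n => x ^ n := by
  ext n
  cases n <;> simp [mul_assoc, coeff_succ_X_mul, pow_succ', coeff_one]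

theorem mk_pow_mul_one_sub (x : R) :
    (PowerSeries.mk fun n => x ^ n) * (1 - C x * X) = 1 := by
  linear_combination mk_pow_eq_one_add x

/-- The series `∏ (1 + yᵢ T) / (1 - xᵢ T)`, the generating function of the `h_r[x|y]`, with the
geometric series standing for `1 / (1 - xᵢ T)`. -/
noncomputable def genSeries {N : ℕ} (x y : Fin N → R) : R⟦X⟧ :=
  ∏ i, (1 + C (y i) * X) * PowerSeries.mk fun n => x i ^ n

theorem map_genSeries {S : Type*} [CommRing S] (f : R →+* S) {N : ℕ} (x y : Fin N → R) :
    PowerSeries.map f (genSeries x y) = genSeries (fun i => f (x i)) fun i => f (y i) := by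
  simp only [genSeries, map_prod, map_mul, map_add, map_one, PowerSeries.map_C, PowerSeries.map_X]
  refine Finset.prod_congr rfl fun i _ => ?_
  congr 1
  ext n
  simp

theorem constantCoeff_genSeries {N : ℕ} (x y : Fin N → R) : constantCoeff (genSeries x y) = 1 := by
  simp [genSeries, map_prod]

/-- The first `n` coefficients of a power series: the projection of `R⟦X⟧` onto `R[T] / (T ^ n)` in
the basis of powers of `T`. -/
noncomputable def initialCoeffs (n : ℕ) : R⟦X⟧ →ₗ[R] (Fin n → R) :=
  LinearMap.pi fun i => coeff (i : ℕ)

theorem initialCoeffs_apply {n : ℕ} (F : R⟦X⟧) (i : Fin n) :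
    initialCoeffs n F i = coeff (i : ℕ) F := rfl

theorem sum_rowFunction_smul_wedge_initialCoeffs {x y u v : R} (huv : u * v = x + y) (A B : R)
    {n : ℕ} (F : R⟦X⟧) (t : Fin n → Spin) :
    ∑ b, rowFunction (freeFermionWeight x y A B u v) .plus b t •
        wedge R (fun j : Fin n => initialCoeffs n (X ^ (j : ℕ) * F)) b =
      A ^ n • wedge R (fun j : Fin n => initialCoeffs n (X ^ (j : ℕ) *
        (F * (C B * ((1 + C y * X) * PowerSeries.mk fun n => x ^ n))))) t := by
  set E := PowerSeries.mk fun n => x ^ n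
  have hgeom : E = 1 + C x * X * E := mk_pow_eq_one_add x
  have hrow := sum_rowFunction_smul_wedge huv A B
    (fun j : Fin n => initialCoeffs n (X ^ (j : ℕ) * F))
    (fun j => initialCoeffs n (X ^ (j : ℕ) * (C B * F * E)))
    (by ext i; simp [initialCoeffs_apply, coeff_X_pow_mul'])
    (fun j => by
      simp only [← map_smul, ← map_add, smul_eq_C_mul, Fin.val_castSucc, Fin.val_succ]
      congr 1
      linear_combination (X ^ (j : ℕ) * C B * F) * hgeom) .plus t
  rw [hrow]
  simp only [← map_smul, ← map_add, smul_eq_C_mul, Fin.val_succ, reduceCtorEq, if_false, one_mul]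
  congr 3
  funext j
  rw [map_add C]
  congr 1
  linear_combination (- X ^ (j : ℕ) * C B * F) * hgeom

theorem sum_pathSum_smul_wedge_initialCoeffs {N : ℕ} {x y u v : Fin N → R}
    (huv : ∀ k, u k * v k = x k + y k) (A B : Fin N → R) {n : ℕ} (F : R⟦X⟧) (t : Fin n → Spin) :
    ∑ b, pathSum (fun k => rowFunction
        (freeFermionWeight (x k) (y k) (A k) (B k) (u k) (v k)) .plus) b t •
          wedge R (fun j : Fin n => initialCoeffs n (X ^ (j : ℕ) * F)) b =
      (∏ k, A k ^ n) • wedge R (fun j : Fin n => initialCoeffs n (X ^ (j : ℕ) *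
        (F * (C (∏ k, B k) * genSeries x y)))) t := by
  induction N generalizing F with
  | zero => simp [pathSum_zero, genSeries]
  | succ N ih =>
    simp only [pathSum_succ, Finset.sum_smul]
    rw [Finset.sum_comm]
    simp only [mul_comm (rowFunction _ _ _ _), mul_smul, ← Finset.smul_sum,
      sum_rowFunction_smul_wedge_initialCoeffs (huv 0), smul_comm _ (A 0 ^ n)]
    have ih' := ih (fun k => huv k.succ) (fun k => A k.succ) (fun k => B k.succ)
      (F * (C (B 0) * ((1 + C (y 0) * X) * PowerSeries.mk fun n => x 0 ^ n)))
    refine (congrArg _ ih').trans ?_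
    rw [smul_smul, Fin.prod_univ_succ, Fin.prod_univ_succ, genSeries, genSeries,
      Fin.prod_univ_succ, map_mul]
    congr 3
    funext j
    congr 2
    ring

theorem minorAt_wedge_initialCoeffs {l n : ℕ} (p : Fin l → Fin n) {q : Fin l → Fin n}
    (hq : StrictMono q) {t : Fin n → Spin} (ht : IsMinusSet q t) (c : R) (F : R⟦X⟧) :
    minorAt p (wedge R (fun j : Fin n => initialCoeffs n (X ^ (j : ℕ) * (C c * F))) t) =
      c ^ l * (Matrix.of fun i j => coeff (p i : ℕ) (X ^ (q j : ℕ) * F)).det := by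
  rw [minorAt_wedge p hq ht, ← Matrix.det_transpose]
  refine (congrArg Matrix.det ?_).trans ((Matrix.det_smul _ c).trans (by rw [Fintype.card_fin]))
  ext i j
  simp [initialCoeffs_apply, mul_left_comm _ (C c)]

theorem pathSum_rowFunction_eq_det {N : ℕ} {x y u v : Fin N → R}
    (huv : ∀ k, u k * v k = x k + y k) (A B : Fin N → R) {n l : ℕ} {p q : Fin l → Fin n}
    (hp : StrictMono p) (hq : StrictMono q) {b t : Fin n → Spin} (hb : IsMinusSet p b)
    (ht : IsMinusSet q t) :
    pathSum (fun k => rowFunction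
        (freeFermionWeight (x k) (y k) (A k) (B k) (u k) (v k)) .plus) b t =
      (∏ k, A k ^ n * B k ^ l) * (Matrix.of fun i j =>
        coeff (p i : ℕ) (X ^ (q j : ℕ) * genSeries x y)).det := by
  have h := congrArg (minorAt p) (sum_pathSum_smul_wedge_initialCoeffs huv A B 1 t)
  have hsingle : (fun j : Fin n => initialCoeffs n (X ^ (j : ℕ) * 1 : R⟦X⟧)) =
      fun j => Pi.single j 1 := by
    ext j i
    simp [initialCoeffs_apply, coeff_X_pow, Pi.single_apply, Fin.ext_iff]
  simp only [hsingle, map_sum, map_smul, smul_eq_mul] at h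
  rw [Finset.sum_eq_single b _ (by simp), minorAt_wedge_single_self hp hb, mul_one] at h
  · rw [h, one_mul, minorAt_wedge_initialCoeffs p hq ht, Finset.prod_mul_distrib,
      Finset.prod_pow _ l B, mul_assoc]
  · intro b' _ hb'
    rw [minorAt_wedge_single_of_not hp fun h => hb' (h.eq hb), mul_zero]

end Transfer

/-! ### The one-row functions `h_r` -/

section Alternants

open Polynomial

/-- The coefficient of `T` in `F(T) P(T⁻¹)`, that is, up to sign the residue of `F(z⁻¹) P(z)` at
`z = ∞`. -/
noncomputable def residue (F : PowerSeries R) : R[X] →ₗ[R] R :=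
  lsum fun i => PowerSeries.coeff (i + 1) F • LinearMap.id

theorem residue_X_pow (F : PowerSeries R) (m : ℕ) :
    residue F (X ^ m) = PowerSeries.coeff (m + 1) F := by
  rw [residue, lsum_apply, ← monomial_one_right_eq_X_pow, sum_monomial_index] <;> simp

theorem residue_one (P : R[X]) : residue 1 P = 0 := by
  simp [residue, lsum_apply, Polynomial.sum_def, PowerSeries.coeff_one]

theorem residue_X_mul (F : PowerSeries R) (P : R[X]) (a : R) :
    residue (PowerSeries.X * F) (P * (X + C a)) =
      residue (F * (1 + PowerSeries.C a * PowerSeries.X)) P := by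
  induction P using Polynomial.induction_on' with
  | add P Q hP hQ => rw [add_mul, map_add, map_add, hP, hQ]
  | monomial m c =>
    have hX : (X ^ m : R[X]) * (X + C a) = X ^ (m + 1) + a • X ^ m := by
      rw [smul_eq_C_mul]; ring
    rw [← mul_one c, ← smul_eq_mul c, ← smul_monomial, monomial_one_right_eq_X_pow,
      smul_mul_assoc, hX]
    simp only [map_smul, map_add, residue_X_pow, PowerSeries.coeff_succ_X_mul, mul_add, mul_one,
      mul_left_comm F, PowerSeries.coeff_C_mul, PowerSeries.coeff_succ_mul_X, smul_eq_mul]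

theorem residue_X_pow_mul {N : ℕ} (F : PowerSeries R) (P : R[X]) (a : Fin N → R) :
    residue (PowerSeries.X ^ N * F) (P * ∏ i, (X + C (a i))) =
      residue (F * ∏ i, (1 + PowerSeries.C (a i) * PowerSeries.X)) P := by
  induction N generalizing F with
  | zero => simp
  | succ N ih =>
    rw [Fin.prod_univ_succ, Fin.prod_univ_succ, pow_succ', mul_assoc, mul_left_comm P,
      mul_comm (X + _), residue_X_mul, mul_assoc, ih, mul_assoc]

theorem residue_X_pow_succ_mul {n : ℕ} {F : PowerSeries R}
    (hF : PowerSeries.constantCoeff F = 1) {P : R[X]} (hP : P.natDegree ≤ n) :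
    residue (PowerSeries.X ^ (n + 1) * F) P = P.coeff n := by
  rw [residue, lsum_apply, sum_over_range' _ _ (n + 1) (by omega), Finset.sum_range_succ,
    Finset.sum_eq_zero]
  · simp [PowerSeries.coeff_X_pow_mul', hF]
  · intro i hi
    simp [PowerSeries.coeff_X_pow_mul', (Finset.mem_range.1 hi).not_ge]
  · simp

/-- The monic polynomial `∏ (X - xᵢ)`. Reduction modulo it does not change values at the `xᵢ`, hence
does not change alternants. -/
noncomputable def rootPoly {N : ℕ} (x : Fin N → R) : R[X] := ∏ i, (X - C (x i))

theorem monic_rootPoly {N : ℕ} (x : Fin N → R) : (rootPoly x).Monic :=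
  monic_prod_of_monic _ _ fun _ _ => monic_X_sub_C _

theorem natDegree_rootPoly [Nontrivial R] {N : ℕ} (x : Fin N → R) :
    (rootPoly x).natDegree = N := by
  rw [rootPoly, natDegree_prod_of_monic _ _ fun _ _ => monic_X_sub_C _]
  simp

theorem natDegree_modByMonic_rootPoly_le {n : ℕ} (x : Fin (n + 1) → R) (P : R[X]) :
    (P %ₘ rootPoly x).natDegree ≤ n := by
  nontriviality R
  have hdeg := natDegree_rootPoly x
  have hlt := natDegree_modByMonic_lt P (monic_rootPoly x) fun h => by simp [h] at hdeg
  omega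

theorem eval_modByMonic_rootPoly {N : ℕ} (x : Fin N → R) (P : R[X]) (i : Fin N) :
    (P %ₘ rootPoly x).eval (x i) = P.eval (x i) :=
  eval₂_modByMonic_eq_self_of_root <| by
    rw [eval₂_id, rootPoly, eval_prod]
    exact Finset.prod_eq_zero (Finset.mem_univ i) (by simp)

theorem coeff_modByMonic_rootPoly {n : ℕ} (x : Fin (n + 1) → R) (P : R[X]) :
    (P %ₘ rootPoly x).coeff n =
      residue (PowerSeries.X ^ (n + 1) * ∏ i, PowerSeries.mk fun n => x i ^ n) P := by
  set V : PowerSeries R := ∏ i, PowerSeries.mk fun n => x i ^ n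
  have hV : PowerSeries.constantCoeff V = 1 := by
    simp [V, map_prod]
  have hinv : V * ∏ i, (1 + PowerSeries.C (-x i) * PowerSeries.X) = 1 := by
    simp [V, ← Finset.prod_mul_distrib, ← sub_eq_add_neg, mk_pow_mul_one_sub]
  -- `X ^ (n + 1) * V` is `∏ T / (1 - xᵢ T)`, which cancels `rootPoly x` at `T⁻¹`.
  have hroot : residue (PowerSeries.X ^ (n + 1) * V) (rootPoly x * (P /ₘ rootPoly x)) = 0 := by
    have h := residue_X_pow_mul V (P /ₘ rootPoly x) fun i => -x i
    simpa only [hinv, residue_one, mul_comm (P /ₘ _), C_neg, ← sub_eq_add_neg, rootPoly] using h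
  rw [← residue_X_pow_succ_mul hV (natDegree_modByMonic_rootPoly_le x P)]
  conv_rhs => rw [← modByMonic_add_div P (rootPoly x), map_add, hroot, add_zero]

/-- The shifted power `[t|y]^r` as a polynomial in `t`. -/
noncomputable def shiftedPowPoly {N : ℕ} (y : Fin N → R) (r : ℕ) : R[X] :=
  shiftedPow X (fun k => C (y k)) r

theorem shiftedPowPoly_eq_prod {N : ℕ} (y : Fin N → R) (r : ℕ) :
    shiftedPowPoly y r =
      ∏ k ∈ Finset.range r, (X + C (if h : k < N then y ⟨k, h⟩ else 0)) := by
  simp only [shiftedPowPoly, shiftedPow, apply_dite C, C_0]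

theorem eval_shiftedPowPoly {N : ℕ} (y : Fin N → R) (r : ℕ) (t : R) :
    (shiftedPowPoly y r).eval t = shiftedPow t y r := by
  simp [shiftedPowPoly_eq_prod, shiftedPow, eval_prod]

theorem monic_shiftedPowPoly {N : ℕ} (y : Fin N → R) (r : ℕ) : (shiftedPowPoly y r).Monic := by
  rw [shiftedPowPoly_eq_prod]
  exact monic_prod_of_monic _ _ fun _ _ => monic_X_add_C _

theorem natDegree_shiftedPowPoly [Nontrivial R] {N : ℕ} (y : Fin N → R) (r : ℕ) :
    (shiftedPowPoly y r).natDegree = r := by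
  rw [shiftedPowPoly_eq_prod, natDegree_prod_of_monic _ _ fun _ _ => monic_X_add_C _]
  simp

theorem shiftedPowPoly_add {N : ℕ} (y : Fin N → R) (r : ℕ) :
    shiftedPowPoly y (N + r) = X ^ r * ∏ i, (X + C (y i)) := by
  rw [shiftedPowPoly_eq_prod, Finset.prod_range_add, Finset.prod_range, mul_comm]
  simp

theorem coeff_shiftedPowPoly_modByMonic {n : ℕ} (x y : Fin (n + 1) → R) (r : ℕ) :
    (shiftedPowPoly y (n + r) %ₘ rootPoly x).coeff n = PowerSeries.coeff r (genSeries x y) := by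
  nontriviality R
  cases r with
  | zero =>
    have hself : shiftedPowPoly y n %ₘ rootPoly x = shiftedPowPoly y n := by
      rw [modByMonic_eq_self_iff (monic_rootPoly x)]
      exact degree_lt_degree (by simp [natDegree_rootPoly, natDegree_shiftedPowPoly])
    have hlead := (monic_shiftedPowPoly y n).coeff_natDegree
    rw [natDegree_shiftedPowPoly] at hlead
    simp [hself, hlead, constantCoeff_genSeries]
  | succ r =>
    rw [coeff_modByMonic_rootPoly, show n + (r + 1) = n + 1 + r by omega, shiftedPowPoly_add,
      residue_X_pow_mul, residue_X_pow, ← Finset.prod_mul_distrib, genSeries]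
    simp only [mul_comm]

theorem det_eval_of_natDegree_le {n : ℕ} (x : Fin n → R) (p : Fin n → R[X])
    (hp : ∀ j, (p j).natDegree ≤ j) :
    (Matrix.of fun i j => (p j).eval (x i)).det =
      (Matrix.vandermonde x).det * ∏ j, (p j).coeff j := by
  rw [Matrix.eval_matrixOfPolynomials_eq_vandermonde_mul_matrixOfPolynomials x p hp,
    Matrix.det_mul,
    Matrix.det_of_isUpperTriangular (Matrix.matrixOfPolynomials_blockTriangular p hp)]
  rfl

theorem alternant_oneRow {n : ℕ} (x y : Fin (n + 1) → R) (r : ℕ) :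
    alternant x y (rhoShift (oneRow (n + 1) r)) =
      Equiv.Perm.sign (Fin.revPerm (n := n + 1)) * (Matrix.vandermonde x).det *
        PowerSeries.coeff r (genSeries x y) := by
  nontriviality R
  let p : Fin (n + 1) → R[X] := Fin.snoc (fun j : Fin n => shiftedPowPoly y j)
    (shiftedPowPoly y (n + r) %ₘ rootPoly x)
  have hdeg : ∀ j, (p j).natDegree ≤ j := Fin.lastCases
    (by simpa [p] using natDegree_modByMonic_rootPoly_le x _)
    fun j => by simp [p, natDegree_shiftedPowPoly]
  have hcoeff : ∏ j, (p j).coeff j = PowerSeries.coeff r (genSeries x y) := by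
    have hone (j : ℕ) : (shiftedPowPoly y j).coeff j = 1 := by
      simpa [natDegree_shiftedPowPoly] using (monic_shiftedPowPoly y j).coeff_natDegree
    simp [p, Fin.prod_univ_castSucc, hone, coeff_shiftedPowPoly_modByMonic]
  have hcol : (Matrix.of fun i j => shiftedPow (x i) y (rhoShift (oneRow (n + 1) r) j)) =
      (Matrix.of fun i j => (p j).eval (x i)).submatrix id Fin.revPerm := by
    ext i j
    induction j using Fin.cases with
    | zero => simp [p, eval_modByMonic_rootPoly, eval_shiftedPowPoly, rhoShift, oneRow, add_comm]
    | succ j =>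
      simp [p, eval_shiftedPowPoly, rhoShift, oneRow, Fin.rev_succ]
  rw [alternant, hcol, Matrix.det_permute', det_eval_of_natDegree_le x p hdeg, hcoeff, mul_assoc]

theorem alternant_rho_mul_superSchurPoly (N : ℕ) (lam : Fin N → ℕ) :
    alternant (fun i => MvPolynomial.X (Sum.inl i)) (fun i => MvPolynomial.X (Sum.inr i))
        (rhoShift 0) * superSchurPoly N lam =
      alternant (fun i => MvPolynomial.X (Sum.inl i)) (fun i => MvPolynomial.X (Sum.inr i))
        (rhoShift lam) :=
  (Classical.choose_spec (alternant_rho_dvd _ _ _)).symm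

theorem superSchurPoly_oneRow (n r : ℕ) :
    superSchurPoly (n + 1) (oneRow (n + 1) r) = PowerSeries.coeff r
      (genSeries (fun i => MvPolynomial.X (Sum.inl i)) fun i => MvPolynomial.X (Sum.inr i)) := by
  have hzero : (0 : Fin (n + 1) → ℕ) = oneRow (n + 1) 0 := by
    ext i
    simp [oneRow]
  have hspec := alternant_rho_mul_superSchurPoly (n + 1) (oneRow (n + 1) r)
  rw [hzero, alternant_oneRow, alternant_oneRow, PowerSeries.coeff_zero_eq_constantCoeff_apply,
    constantCoeff_genSeries, mul_one] at hspec
  refine (mul_left_cancel₀ (mul_ne_zero ?_ ?_) hspec)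
  · rcases Int.units_eq_one_or (Equiv.Perm.sign (Fin.revPerm (n := n + 1))) with h | h <;>
      simp [h]
  · exact Matrix.det_vandermonde_ne_zero_iff.2
      (MvPolynomial.X_injective.comp Sum.inl_injective)

theorem superH_natCast {n : ℕ} (x y : Fin (n + 1) → R) (r : ℕ) :
    superH x y r = PowerSeries.coeff r (genSeries x y) := by
  have hmap := map_genSeries
    (MvPolynomial.aeval (Sum.elim x y) : MvPolynomial _ ℤ →ₐ[ℤ] R).toRingHom
    (fun i => MvPolynomial.X (Sum.inl i)) fun i => MvPolynomial.X (Sum.inr i)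
  simp only [AlgHom.toRingHom_eq_coe, RingHom.coe_coe, MvPolynomial.aeval_X, Sum.elim_inl,
    Sum.elim_inr] at hmap
  rw [superH, if_pos (Nat.cast_nonneg r), Int.toNat_natCast, superSchurPoly_oneRow, ← hmap,
    PowerSeries.coeff_map, RingHom.coe_coe]

theorem superH_natCast_sub_natCast {n : ℕ} (x y : Fin (n + 1) → R) (i j : ℕ) :
    superH x y ((i : ℤ) - j) = PowerSeries.coeff i (PowerSeries.X ^ j * genSeries x y) := by
  rw [PowerSeries.coeff_X_pow_mul']
  split_ifs with h
  · rw [← Nat.cast_sub h, superH_natCast]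
  · exact if_neg (by omega)

end Alternants

/-! ### Partition functions -/

theorem strictAnti_rhoShift {l : ℕ} {lam : Fin l → ℕ} (h : Antitone lam) :
    StrictAnti (rhoShift lam) := fun i j hij => by
  have hle := h hij.le
  simp only [rhoShift]
  omega

theorem natCast_rhoShift_sub {l : ℕ} (lam mu : Fin l → ℕ) (i j : Fin l) :
    (rhoShift lam i : ℤ) - rhoShift mu j = lam i - mu j - (i : ℕ) + (j : ℕ) := by
  simp only [rhoShift]
  omega

theorem skewSuperSchur_eq_det {n l : ℕ} (lam mu : Fin l → ℕ) (x y : Fin (n + 1) → R) :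
    skewSuperSchur lam mu x y = (Matrix.of fun i j => PowerSeries.coeff (rhoShift lam i)
      (PowerSeries.X ^ rhoShift mu j * genSeries x y)).det := by
  simp only [skewSuperSchur, ← natCast_rhoShift_sub, superH_natCast_sub_natCast]

/-- The columns carrying the parts of a decreasing sequence, listed from left to right, that is,
from the smallest part to the largest. -/
def columns {l M : ℕ} (part : Fin l → ℕ) (h : ∀ i, part i ≤ M) (i : Fin l) : Fin (M + 1) :=
  ⟨part i.rev, Nat.lt_succ_of_le (h i.rev)⟩

theorem strictMono_columns {l M : ℕ} {part : Fin l → ℕ} (hpart : StrictAnti part)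
    (h : ∀ i, part i ≤ M) : StrictMono (columns part h) :=
  fun _ _ hij => hpart (Fin.rev_lt_rev.2 hij)

theorem isMinusSet_columns {l M : ℕ} {part : Fin l → ℕ} (h : ∀ i, part i ≤ M) :
    IsMinusSet (columns part h) (boundarySpin M part) := fun j => by
  have hrange : j ∈ Set.range (columns part h) ↔ ∃ i, part i = (j : ℕ) := by
    simp only [Set.mem_range, columns, Fin.ext_iff]
    exact (Fin.rev_surjective.exists (p := fun i => part i = j)).symm
  simp [boundarySpin, hrange]

theorem partitionFunction_freeFermionWeight {n M l : ℕ} {lam mu : Fin l → ℕ} (hlam : Antitone lam)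
    (hmu : Antitone mu) (hlamM : ∀ i, rhoShift lam i ≤ M) (hmuM : ∀ i, rhoShift mu i ≤ M)
    {x y u v : Fin (n + 1) → R} (huv : ∀ k, u k * v k = x k + y k) (A B : Fin (n + 1) → R) :
    partitionFunction (fun k => freeFermionWeight (x k) (y k) (A k) (B k) (u k) (v k))
        (boundarySpin M (rhoShift lam)) (boundarySpin M (rhoShift mu)) =
      (∏ k, A k ^ (M + 1) * B k ^ l) * skewSuperSchur lam mu x y := by
  rw [partitionFunction_eq_pathSum, pathSum_rowFunction_eq_det huv A B
    (strictMono_columns (strictAnti_rhoShift hlam) hlamM)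
    (strictMono_columns (strictAnti_rhoShift hmu) hmuM)
    (isMinusSet_columns hlamM) (isMinusSet_columns hmuM), skewSuperSchur_eq_det,
    ← Matrix.det_submatrix_equiv_self Fin.revPerm
      (Matrix.of fun i j => PowerSeries.coeff (rhoShift lam i) _)]
  rfl

theorem Z_eq_skewSuperSchur {n M l : ℕ} {lam mu : Fin l → ℕ} (hlam : Antitone lam)
    (hmu : Antitone mu) (hlamM : ∀ i, rhoShift lam i ≤ M) (hmuM : ∀ i, rhoShift mu i ≤ M)
    (x y A B : Fin (n + 1) → R) :
    Z M x y A B (rhoShift lam) (rhoShift mu) =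
      (∏ i, A i ^ (M + 1) * B i ^ l) * skewSuperSchur lam mu x y := by
  simp only [Z, weight_eq_freeFermionWeight]
  exact partitionFunction_freeFermionWeight hlam hmu hlamM hmuM (fun _ => mul_one _) A B

theorem ZStar_eq_skewSuperSchur {n M l : ℕ} {lam mu : Fin l → ℕ} (hlam : Antitone lam)
    (hmu : Antitone mu) (hlamM : ∀ i, rhoShift lam i ≤ M) (hmuM : ∀ i, rhoShift mu i ≤ M)
    (x y : Fin (n + 1) → R) (A B : Fin (n + 1) → Rˣ) :
    ZStar M x y A B (rhoShift lam) (rhoShift mu) =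
      ((∏ i, A i ^ (-((M : ℤ) + 1)) * B i ^ (-(l : ℤ)) : Rˣ) : R) *
        skewSuperSchur lam mu y x := by
  rw [ZStar, partitionFunction_flip]
  simp only [Fin.rev_rev, weightStar_eq_freeFermionWeight]
  rw [partitionFunction_freeFermionWeight hlam hmu hlamM hmuM
    (fun k => by rw [one_mul, add_comm])]
  congr 1
  simp only [zpow_neg, ← Nat.cast_succ, zpow_natCast]
  push_cast
  rfl

end SixVertex

theorem mainTheorem4 {R : Type*} [CommRing R] (N M l : ℕ) (hN : 1 ≤ N)
    (lam mu : Fin l → ℕ) (hlam : Antitone lam) (hmu : Antitone mu)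
    (hlamM : ∀ i, SixVertex.rhoShift lam i ≤ M) (hmuM : ∀ i, SixVertex.rhoShift mu i ≤ M)
    (x y : Fin N → R) :
    (∀ A B : Fin N → R,
      SixVertex.Z M x y A B (SixVertex.rhoShift lam) (SixVertex.rhoShift mu) =
        (∏ i, A i ^ (M + 1) * B i ^ l) * SixVertex.skewSuperSchur lam mu x y) ∧
    (∀ A B : Fin N → Rˣ,
      SixVertex.ZStar M x y A B (SixVertex.rhoShift lam) (SixVertex.rhoShift mu) =
        ((∏ i, A i ^ (-((M : ℤ) + 1)) * B i ^ (-(l : ℤ)) : Rˣ) : R) *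
          SixVertex.skewSuperSchur lam mu y x) := by
  obtain ⟨n, rfl⟩ := Nat.exists_eq_add_of_le' hN
  exact ⟨SixVertex.Z_eq_skewSuperSchur hlam hmu hlamM hmuM x y,
    SixVertex.ZStar_eq_skewSuperSchur hlam hmu hlamM hmuM x y⟩
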